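/- Let $\omega=\{0,1,2,\dots\}$ and let $(\xi^\alpha_n : \alpha<\omega_1 \text{ limit},\ n\ge 1)$ be any ladder system on $\omega_1$, i.e. $\xi^\alpha_1<\xi^\alpha_2<\cdots$ converges to $\alpha$ for every limit ordinal $0<\alpha<\omega_1$. The Schreier families $\mathcal S_\alpha$ ($\alpha<\omega_1$) of finite subsets of $\omega\setminus\{0\}$ are defined recursively: $\mathcal S_0$ consists of the sets with at most one element; $\mathcal S_{\alpha+1}$ consists of $\emptyset$ and all unions $E_1\cup\dots\cup E_n$ with $n\ge 1$, $E_j\in\mathcal S_\alpha\setminus\{\emptyset\}$, $n\le\min E_1$ and $\max E_j<\min E_{j+1}$ for $1\le j<n$; for limit $\alpha$, $\mathcal S_\alpha$ consists of $\emptyset$ and all $E\neq\emptyset$ such that $E\in\mathcal S_{\xi^\alpha_k}$ for some $1\le k\le\min E$. Let $\lambda_k=2^{-n}$ if $2^n\le k<2^{n+1}$, and for $A\subseteq\omega$ let $$\varphi_\alpha(A)=\sup\Big\{\sum_{i\in A\cap F}\lambda_i : F\in\mathcal S_\alpha\Big\}\in[0,\infty].$$ Put $\mathrm{Fin}(\varphi_\alpha)=\{A\subseteq\omega:\varphi_\alpha(A)<\infty\}$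 and let the Schreier ideal $\mathcal I_\alpha=\mathrm{Exh}(\varphi_\alpha)$ be the set of all $A\subseteq\omega$ with $\inf\{\varphi_\alpha(A\setminus F): F\subseteq\omega\text{ finite}\}=0$. Then the following hold. 1. If $0<\beta<\omega_1$, then $\mathcal I_\beta$ is not an $F_\sigma$ subset of $\mathcal P(\omega)$, where $\mathcal P(\omega)$ is identified with the Cantor space $2^\omega$. 2. If $\alpha<\beta<\omega_1$, then $\mathcal I_\beta\subsetneq\mathrm{Fin}(\varphi_\beta)$, and $\mathrm{Fin}(\varphi_\beta)\subsetneq\mathcal I_\alpha$ unless $\alpha=0$ and $\beta=1$; in this exceptional case $\mathrm{Fin}(\varphi_1)=\mathcal P(\omega)=\mathcal I_0$. 3. In particular, if $\beta<\omega_1$ is a limit ordinal, then $\mathcal I_\beta\subsetneq\bigcap_{\alpha<\beta}\mathcal I_\alpha$. -/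

import Mathlib

open scoped ENNReal NNReal Ordinal

namespace SchreierIdeals

/-- `ξ α 1 < ξ α 2 < ⋯` tends to `α`, for every limit ordinal `α < ω₁`. The values of `ξ α n` for
`n = 0` and for all other ordinals `α` are irrelevant. -/
def IsLadderSystem (ξ : Ordinal.{0} → ℕ → Ordinal.{0}) : Prop :=
  ∀ α : Ordinal.{0}, α < ω_ 1 → Order.IsSuccLimit α →
    (∀ n, 1 ≤ n → ξ α n < ξ α (n + 1)) ∧
    (∀ n, 1 ≤ n → ξ α n < α) ∧
    (∀ γ, γ < α → ∃ n, 1 ≤ n ∧ γ < ξ α n)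

/-- The family of sets of at most one element, the element being positive. -/
def zeroFamily : Set (Finset ℕ) := {E | E.card ≤ 1 ∧ ∀ x ∈ E, 1 ≤ x}

/-- The empty set together with all unions `E₁ ∪ ⋯ ∪ Eₙ`, where `n ≥ 1` and `Eⱼ` are nonempty
members of `S` with `{n} ≤ E₁ < E₂ < ⋯ < Eₙ`. -/
def succFamily (S : Set (Finset ℕ)) : Set (Finset ℕ) :=
  {F | F = ∅ ∨ ∃ n : ℕ, 1 ≤ n ∧ ∃ E : Fin n → Finset ℕ,
    (∀ i, E i ∈ S ∧ (E i).Nonempty) ∧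
    (∀ i, ∀ x ∈ E i, n ≤ x) ∧
    (∀ i j, i < j → ∀ x ∈ E i, ∀ y ∈ E j, x < y) ∧
    F = Finset.univ.biUnion E}

/-- The Schreier family of order `α`, by recursion on `α`. In the limit step the side condition
`ξ α k < α` only serves the recursion; it always holds for a ladder system `ξ` and `α < ω₁`. -/
noncomputable def schreierFamily (ξ : Ordinal.{0} → ℕ → Ordinal.{0}) (α : Ordinal.{0}) :
    Set (Finset ℕ) :=
  Ordinal.limitRecOn (motive := fun _ => Set (Finset ℕ)) α
    zeroFamily
    (fun _ S => succFamily S)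
    (fun α _ S => {E | E = ∅ ∨ ∃ k : ℕ, 1 ≤ k ∧ (∀ x ∈ E, k ≤ x) ∧ ∃ h : ξ α k < α, E ∈ S (ξ α k) h})

theorem schreierFamily_zero (ξ : Ordinal.{0} → ℕ → Ordinal.{0}) :
    schreierFamily ξ 0 = zeroFamily := by
  simp [schreierFamily]

theorem schreierFamily_succ (ξ : Ordinal.{0} → ℕ → Ordinal.{0}) (α : Ordinal.{0}) :
    schreierFamily ξ (Order.succ α) = succFamily (schreierFamily ξ α) := by
  simp [schreierFamily]

theorem schreierFamily_limit {ξ : Ordinal.{0} → ℕ → Ordinal.{0}} (hξ : IsLadderSystem ξ)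
    {α : Ordinal.{0}} (hα : α < ω_ 1) (hlim : Order.IsSuccLimit α) :
    schreierFamily ξ α =
      {E | E = ∅ ∨ ∃ k : ℕ, 1 ≤ k ∧ (∀ x ∈ E, k ≤ x) ∧ E ∈ schreierFamily ξ (ξ α k)} := by
  ext E
  unfold schreierFamily
  rw [Ordinal.limitRecOn_limit _ _ _ _ hlim]
  constructor
  · rintro (h | ⟨k, hk, hE, _, h⟩)
    · exact Or.inl h
    · exact Or.inr ⟨k, hk, hE, h⟩
  · rintro (h | ⟨k, hk, hE, h⟩)
    · exact Or.inl h
    · exact Or.inr ⟨k, hk, hE, (hξ α hα hlim).2.1 k hk, h⟩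

/-- The weights `λ k = 2⁻ⁿ` for `2ⁿ ≤ k < 2ⁿ⁺¹`. The value at `k = 0` is irrelevant, since no
member of a Schreier family contains `0`. -/
noncomputable def lam (k : ℕ) : ℝ≥0 := 2⁻¹ ^ Nat.log 2 k

/-- `A ↦ sup {∑_{i ∈ A ∩ F} τ i : F ∈ 𝓕}`. -/
noncomputable def familySubmeasure (𝓕 : Set (Finset ℕ)) (τ : ℕ → ℝ≥0) (A : Set ℕ) : ℝ≥0∞ :=
  ⨆ F ∈ 𝓕, ∑ i ∈ F, A.indicator (fun i => (τ i : ℝ≥0∞)) i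

/-- `Fin(φ)`, the sets of finite `φ`-value. -/
def FinIdeal (φ : Set ℕ → ℝ≥0∞) : Set (Set ℕ) := {A | φ A < ∞}

/-- `Exh(φ)`, the sets `A` with `inf {φ(A \ F) : F finite} = 0`. -/
def ExhIdeal (φ : Set ℕ → ℝ≥0∞) : Set (Set ℕ) :=
  {A | ⨅ F : Finset ℕ, φ (A \ (F : Set ℕ)) = 0}

/-- The submeasure `φ_α` given by the Schreier family of order `α` and the weights `λ`. -/
noncomputable def schreierSubmeasure (ξ : Ordinal.{0} → ℕ → Ordinal.{0}) (α : Ordinal.{0}) :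
    Set ℕ → ℝ≥0∞ :=
  familySubmeasure (schreierFamily ξ α) lam

/-- The Schreier ideal of order `α`. -/
noncomputable def schreierIdeal (ξ : Ordinal.{0} → ℕ → Ordinal.{0}) (α : Ordinal.{0}) :
    Set (Set ℕ) :=
  ExhIdeal (schreierSubmeasure ξ α)

/-- A family of subsets of `ℕ` is `F_σ` if, as a set of characteristic functions, it is a countable
union of closed subsets of the Cantor space `ℕ → Bool`. -/
def IsFSigma (I : Set (Set ℕ)) : Prop :=
  ∃ C : ℕ → Set (ℕ → Bool), (∀ n, IsClosed (C n)) ∧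
    {x : ℕ → Bool | {n | x n = true} ∈ I} = ⋃ n, C n

end SchreierIdeals

/-! Every strictness claim about positive order comes from complexity. `Fin(φ)` is always `F_σ`,
because `φ` is a supremum of functions of finitely many coordinates. `Exh(φ)` is not `F_σ` once sets
of arbitrarily small `φ`-value lie outside it (`not_isFSigma_exhIdeal`, a Baire-style
diagonalisation).

Such sets are unions of successive blocks `F j` in `𝓢_β`, each of mass `2⁻ʳ`, with `φ_β(⋃ F j) ≤ 3 ·
2⁻ʳ`. They exist if late blocks have small mass in every member of `𝓢_β` that meets a given initial
segment, and this follows from `HasThinSets`. Thin sets are built by induction on `β`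
(`hasThinSets`): the union of `2ˢ` such blocks of mass `2⁻⁽ʳ⁺ˢ⁾` is thin for order `β + 1`.

The inclusion `Fin(φ_β) ⊆ 𝓘_α` reduces to `β = α + 1` (`finIdeal_succ_subset`): late sets in `𝓢_α`
carrying mass `ε` inside `A` can be joined into members of `𝓢_{α+1}` of unbounded mass. -/

open Filter Topology Order

namespace SchreierIdeals

/-! ### Submeasures given by families of finite sets -/

/-- The `τ`-mass of the part of `G` inside `A`. -/
noncomputable def mass (τ : ℕ → ℝ≥0) (A : Set ℕ) (G : Finset ℕ) : ℝ≥0∞ :=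
  ∑ i ∈ G, A.indicator (fun i => (τ i : ℝ≥0∞)) i

section Submeasure

variable {𝓕 𝓖 : Set (Finset ℕ)} {τ : ℕ → ℝ≥0}

theorem mass_mono {A B : Set ℕ} (h : A ⊆ B) (G : Finset ℕ) : mass τ A G ≤ mass τ B G :=
  Finset.sum_le_sum fun _ _ => Set.indicator_le_indicator_of_subset h (fun _ => zero_le) _

theorem mass_le_sum (A : Set ℕ) (G : Finset ℕ) : mass τ A G ≤ ∑ i ∈ G, (τ i : ℝ≥0∞) :=
  Finset.sum_le_sum fun _ _ => Set.indicator_le_self _ _ _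

theorem mass_eq_sum {A : Set ℕ} {G : Finset ℕ} (h : (G : Set ℕ) ⊆ A) :
    mass τ A G = ∑ i ∈ G, (τ i : ℝ≥0∞) :=
  Finset.sum_congr rfl fun _ hi => Set.indicator_of_mem (h hi) _

theorem mass_eq_zero {A : Set ℕ} {G : Finset ℕ} (h : ∀ x ∈ G, x ∉ A) : mass τ A G = 0 :=
  Finset.sum_eq_zero fun _ hi => Set.indicator_of_notMem (h _ hi) _

theorem mass_filter (A : Set ℕ) [DecidablePred (· ∈ A)] (G : Finset ℕ) :
    mass τ A {x ∈ G | x ∈ A} = mass τ A G := by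
  unfold mass
  rw [Finset.sum_filter]
  refine Finset.sum_congr rfl fun i _ => ?_
  split_ifs with h
  · rfl
  · rw [Set.indicator_of_notMem h]

theorem mass_coe_le_sum (F G : Finset ℕ) : mass τ F G ≤ ∑ i ∈ F, (τ i : ℝ≥0∞) := by
  classical
  rw [← mass_filter]
  refine (mass_le_sum _ _).trans (Finset.sum_le_sum_of_subset fun x hx => ?_)
  simpa using (Finset.mem_filter.1 hx).2

theorem mass_iUnion_le (A : ℕ → Set ℕ) (G : Finset ℕ) :
    mass τ (⋃ n, A n) G ≤ ∑' n, mass τ (A n) G := by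
  unfold mass
  rw [Summable.tsum_finsetSum fun _ _ => ENNReal.summable]
  refine Finset.sum_le_sum fun i _ => ?_
  by_cases h : i ∈ ⋃ n, A n
  · obtain ⟨n, hn⟩ := Set.mem_iUnion.1 h
    rw [Set.indicator_of_mem h]
    refine le_trans ?_ (ENNReal.le_tsum n)
    rw [Set.indicator_of_mem hn]
  · rw [Set.indicator_of_notMem h]
    exact zero_le

theorem mass_union_le (A B : Set ℕ) (G : Finset ℕ) :
    mass τ (A ∪ B) G ≤ mass τ A G + mass τ B G := by
  unfold mass
  rw [← Finset.sum_add_distrib]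
  refine Finset.sum_le_sum fun i _ => ?_
  by_cases hA : i ∈ A
  · rw [Set.indicator_of_mem (Set.mem_union_left B hA), Set.indicator_of_mem hA]
    exact le_self_add
  · by_cases hB : i ∈ B
    · rw [Set.indicator_of_mem (Set.mem_union_right A hB), Set.indicator_of_mem hB]
      exact le_add_self
    · rw [Set.indicator_of_notMem (by simp [hA, hB])]
      exact zero_le

theorem mass_biUnion_le {ι : Type*} (s : Finset ι) (E : ι → Finset ℕ) (A : Set ℕ) :
    mass τ A (s.biUnion E) ≤ ∑ i ∈ s, mass τ A (E i) := by
  classical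
  induction s using Finset.induction_on with
  | empty => simp [mass]
  | insert a s ha ih =>
    rw [Finset.biUnion_insert, Finset.sum_insert ha]
    refine le_trans ?_ (add_le_add_right ih _)
    unfold mass
    rw [← Finset.sum_union_inter]
    exact le_self_add

theorem mass_le_submeasure {G : Finset ℕ} (hG : G ∈ 𝓕) (A : Set ℕ) :
    mass τ A G ≤ familySubmeasure 𝓕 τ A :=
  le_iSup₂ (f := fun F (_ : F ∈ 𝓕) => mass τ A F) G hG

theorem submeasure_le {A : Set ℕ} {c : ℝ≥0∞} (h : ∀ G ∈ 𝓕, mass τ A G ≤ c) :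
    familySubmeasure 𝓕 τ A ≤ c :=
  iSup₂_le h

theorem submeasure_mono {A B : Set ℕ} (h : A ⊆ B) :
    familySubmeasure 𝓕 τ A ≤ familySubmeasure 𝓕 τ B :=
  submeasure_le fun G hG => (mass_mono h G).trans (mass_le_submeasure hG B)

theorem submeasure_iUnion_le (A : ℕ → Set ℕ) :
    familySubmeasure 𝓕 τ (⋃ n, A n) ≤ ∑' n, familySubmeasure 𝓕 τ (A n) :=
  submeasure_le fun G hG => (mass_iUnion_le A G).trans
    (ENNReal.tsum_le_tsum fun n => mass_le_submeasure hG (A n))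

theorem submeasure_union_le (A B : Set ℕ) :
    familySubmeasure 𝓕 τ (A ∪ B) ≤ familySubmeasure 𝓕 τ A + familySubmeasure 𝓕 τ B :=
  submeasure_le fun G hG => (mass_union_le A B G).trans
    (add_le_add (mass_le_submeasure hG A) (mass_le_submeasure hG B))

theorem submeasure_coe_lt_top (F : Finset ℕ) : familySubmeasure 𝓕 τ F < ∞ :=
  (submeasure_le fun G _ => mass_coe_le_sum F G).trans_lt
    (ENNReal.sum_lt_top.2 fun _ _ => ENNReal.coe_lt_top)

theorem submeasure_lt_top_of_diff {A : Set ℕ} (F : Finset ℕ)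
    (h : familySubmeasure 𝓕 τ (A \ F) < ∞) : familySubmeasure 𝓕 τ A < ∞ := by
  refine (submeasure_mono (B := (A \ F) ∪ F) ?_).trans_lt
    ((submeasure_union_le _ _).trans_lt (ENNReal.add_lt_top.2 ⟨h, submeasure_coe_lt_top F⟩))
  rw [Set.sdiff_union_self]
  exact Set.subset_union_left

/-- A family of finite sets closed under subsets. -/
def Hereditary (𝓕 : Set (Finset ℕ)) : Prop := ∀ E ∈ 𝓕, ∀ D ⊆ E, D ∈ 𝓕

/-- Only `G ∩ A` carries mass; heredity keeps it in `𝓕`, and it starts past `N`. -/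
theorem mass_le_submeasure_of_tail (h𝓕 : Hereditary 𝓕) {N : ℕ}
    (hN : ∀ E ∈ 𝓕, (∀ x ∈ E, N ≤ x) → E ∈ 𝓖) {A : Set ℕ} (hA : ∀ x ∈ A, N ≤ x)
    {G : Finset ℕ} (hG : G ∈ 𝓕) : mass τ A G ≤ familySubmeasure 𝓖 τ A := by
  classical
  rw [← mass_filter]
  exact mass_le_submeasure (hN _ (h𝓕 G hG _ (Finset.filter_subset _ _))
    fun x hx => hA x (Finset.mem_filter.1 hx).2) A

theorem submeasure_le_of_tail (h𝓕 : Hereditary 𝓕) {N : ℕ}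
    (hN : ∀ E ∈ 𝓕, (∀ x ∈ E, N ≤ x) → E ∈ 𝓖) {A : Set ℕ} (hA : ∀ x ∈ A, N ≤ x) :
    familySubmeasure 𝓕 τ A ≤ familySubmeasure 𝓖 τ A :=
  submeasure_le fun _ hG => mass_le_submeasure_of_tail h𝓕 hN hA hG

theorem exhIdeal_mono {A B : Set ℕ} (h : A ⊆ B) (hB : B ∈ ExhIdeal (familySubmeasure 𝓕 τ)) :
    A ∈ ExhIdeal (familySubmeasure 𝓕 τ) :=
  le_antisymm ((iInf_mono fun _ => submeasure_mono (Set.sdiff_subset_sdiff_left h)).trans hB.le)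
    zero_le

theorem mem_exhIdeal_of_forall {φ : Set ℕ → ℝ≥0∞} {A : Set ℕ}
    (h : ∀ ε : ℝ≥0∞, ε ≠ 0 → ∃ F : Finset ℕ, φ (A \ F) ≤ ε) : A ∈ ExhIdeal φ := by
  by_contra hA
  obtain ⟨ε, h0, hε⟩ := exists_between (pos_iff_ne_zero.2 hA)
  obtain ⟨F, hF⟩ := h ε h0.ne'
  exact absurd ((iInf_le _ F).trans hF) (not_le.2 hε)

theorem mem_exhIdeal_of_diff {A : Set ℕ} (F : Finset ℕ)
    (h : A \ F ∈ ExhIdeal (familySubmeasure 𝓕 τ)) : A ∈ ExhIdeal (familySubmeasure 𝓕 τ) := by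
  classical
  refine le_antisymm (le_trans (le_iInf fun H => iInf_le_of_le (F ∪ H) ?_) (le_of_eq h)) zero_le
  rw [Finset.coe_union, ← Set.sdiff_sdiff]

theorem notMem_exhIdeal {A : Set ℕ} {ε : ℝ≥0∞} (hε : ε ≠ 0)
    (h : ∀ k, ∃ F ∈ 𝓕, (F : Set ℕ) ⊆ A ∧ (∀ x ∈ F, k ≤ x) ∧ ε ≤ ∑ i ∈ F, (τ i : ℝ≥0∞)) :
    A ∉ ExhIdeal (familySubmeasure 𝓕 τ) := by
  intro hA
  refine hε (le_antisymm (le_trans (le_iInf fun H => ?_) (le_of_eq hA)) zero_le)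
  obtain ⟨F, hF, hFA, hk, hs⟩ := h (H.sup id + 1)
  refine hs.trans ?_
  rw [← mass_eq_sum (A := A \ H)]
  · exact mass_le_submeasure hF _
  · intro x hx
    refine ⟨hFA hx, fun hxH => ?_⟩
    have h1 := hk x hx
    have h2 : x ≤ H.sup id := Finset.le_sup (f := id) hxH
    omega

theorem exhIdeal_subset_finIdeal :
    ExhIdeal (familySubmeasure 𝓕 τ) ⊆ FinIdeal (familySubmeasure 𝓕 τ) := by
  intro A hA
  have h : (⨅ F : Finset ℕ, familySubmeasure 𝓕 τ (A \ (F : Set ℕ))) < 1 := by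
    rw [show _ = (0 : ℝ≥0∞) from hA]
    exact one_pos
  obtain ⟨F, hF⟩ := iInf_lt_iff.1 h
  exact submeasure_lt_top_of_diff F (hF.trans ENNReal.one_lt_top)

/-! ### Descriptive complexity of `Fin(φ)` and `Exh(φ)` -/

theorem isFSigma_univ : IsFSigma Set.univ :=
  ⟨fun _ => Set.univ, fun _ => isClosed_univ, by simp [Set.iUnion_const]⟩

theorem isFSigma_finIdeal : IsFSigma (FinIdeal (familySubmeasure 𝓕 τ)) := by
  refine ⟨fun n => {x | familySubmeasure 𝓕 τ {i | x i = true} ≤ n}, fun n => ?_, ?_⟩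
  · have : {x : ℕ → Bool | familySubmeasure 𝓕 τ {i | x i = true} ≤ n} =
        ⋂ F ∈ 𝓕, {x | mass τ {i | x i = true} F ≤ n} := by
      ext x
      simp only [Set.mem_ofPred_eq, Set.mem_iInter]
      exact iSup₂_le_iff
    simp only [this]
    refine isClosed_biInter fun F _ => isClosed_le ?_ continuous_const
    refine continuous_finsetSum _ fun i _ => ?_
    have : (fun x : ℕ → Bool => {i | x i = true}.indicator (fun i => (τ i : ℝ≥0∞)) i) =
        (fun b : Bool => if b = true then (τ i : ℝ≥0∞) else 0) ∘ fun x => x i := by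
      ext x
      simp [Set.indicator_apply]
    rw [this]
    exact continuous_of_discreteTopology.comp (continuous_apply i)
  · ext x
    simp only [FinIdeal, Set.mem_ofPred_eq, Set.mem_iUnion]
    refine ⟨fun h => ?_, fun ⟨n, h⟩ => h.trans_lt (ENNReal.natCast_lt_top n)⟩
    obtain ⟨n, hn⟩ := ENNReal.exists_nat_gt h.ne
    exact ⟨n, hn.le⟩

/-- In the Cantor space, a set outside a closed family is kept outside by an initial segment. -/
theorem exists_initial_segment {C : Set (ℕ → Bool)} (hC : IsClosed C) {x : ℕ → Bool} (hx : x ∉ C) :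
    ∃ k, ∀ y : ℕ → Bool, (∀ i < k, y i = x i) → y ∉ C := by
  have hU : Cᶜ ∈ 𝓝 x := hC.isOpen_compl.mem_nhds hx
  rw [nhds_pi, Filter.mem_pi'] at hU
  obtain ⟨I, t, ht, hI⟩ := hU
  refine ⟨I.sup id + 1, fun y hy => hI fun i hi => ?_⟩
  rw [hy i (Nat.lt_succ_of_le (Finset.le_sup (f := id) hi))]
  exact mem_of_mem_nhds (ht i)

/-- If there are sets of arbitrarily small submeasure outside `Exh(φ)`, then `Exh(φ)` is not
`F_σ`. -/
theorem not_isFSigma_exhIdeal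
    (h : ∀ δ : ℝ≥0∞, δ ≠ 0 → ∃ X, familySubmeasure 𝓕 τ X ≤ δ ∧
      X ∉ ExhIdeal (familySubmeasure 𝓕 τ)) :
    ¬ IsFSigma (ExhIdeal (familySubmeasure 𝓕 τ)) := by
  classical
  rintro ⟨C, hC, hEq⟩
  have hmem : ∀ B : Set ℕ, B ∈ ExhIdeal (familySubmeasure 𝓕 τ) ↔
      ∃ n, (fun i => decide (i ∈ B)) ∈ C n := by
    intro B
    rw [← Set.mem_iUnion, ← hEq]
    simp
  -- A state `(k, a)` records a set `a` decided below `k`. Adding a late piece `X` of value at most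
  -- `2⁻ⁿ` leaves `Exh(φ)`, and an initial segment of length `k'` already forces the result out of
  -- `C n`.
  have step : ∀ (n : ℕ) (s : ℕ × Set ℕ), ∃ k' X, s.1 < k' ∧
      familySubmeasure 𝓕 τ X ≤ 2⁻¹ ^ n ∧ (∀ x ∈ X, s.1 ≤ x) ∧
      ∀ B : Set ℕ, (∀ i < k', i ∈ B ↔ i ∈ s.2 ∪ X) → (fun i => decide (i ∈ B)) ∉ C n := by
    rintro n ⟨k, a⟩
    obtain ⟨X, hX, hXE⟩ := h (2⁻¹ ^ n) (by simp)
    have hXE' : a ∪ (X \ (Finset.range k : Set ℕ)) ∉ ExhIdeal (familySubmeasure 𝓕 τ) :=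
      fun hE => hXE (mem_exhIdeal_of_diff _ (exhIdeal_mono Set.subset_union_right hE))
    rw [hmem, not_exists] at hXE'
    obtain ⟨m, hm⟩ := exists_initial_segment (hC n) (hXE' n)
    refine ⟨max (k + 1) m, X \ (Finset.range k : Set ℕ), by simp, ?_, ?_, ?_⟩
    · exact (submeasure_mono Set.sdiff_subset).trans hX
    · rintro x ⟨-, hx⟩
      simpa using hx
    · intro B hB
      exact hm _ fun i hi => decide_eq_decide.2 (hB i (lt_max_of_lt_right hi))
  choose K X hK hX hXk hB using step
  let s : ℕ → ℕ × Set ℕ := fun n =>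
    Nat.rec (0, ∅) (fun n s => (K n s, (s.2 ∪ X n s) ∩ Set.Iio (K n s))) n
  have hs1 : ∀ n, (s (n + 1)).1 = K n (s n) := fun n => rfl
  have hs2 : ∀ n, (s (n + 1)).2 = ((s n).2 ∪ X n (s n)) ∩ Set.Iio (K n (s n)) := fun n => rfl
  have hsm : StrictMono fun n => (s n).1 := strictMono_nat_of_lt_succ fun n => hK n (s n)
  have hlt : ∀ n, ∀ x ∈ (s n).2, x < (s n).1 := by
    rintro (_ | n) x hx
    · exact absurd hx (Set.notMem_empty x)
    · exact hx.2
  have hsub : ∀ n m, n ≤ m → (s n).2 ⊆ (s m).2 := by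
    intro n m hnm
    induction m, hnm using Nat.le_induction with
    | base => exact subset_rfl
    | succ m _ ih =>
      exact fun x hx => ⟨Or.inl (ih hx), (hlt m x (ih hx)).trans (hK m (s m))⟩
  have hback : ∀ n m, n ≤ m → ∀ x ∈ (s m).2, x ∈ (s n).2 ∨ ∃ j, x ∈ X (j + n) (s (j + n)) := by
    intro n m hnm
    induction m, hnm using Nat.le_induction with
    | base => exact fun x hx => Or.inl hx
    | succ m hm ih =>
      rintro x ⟨hx | hx, -⟩
      · exact ih x hx
      · exact Or.inr ⟨m - n, by rwa [Nat.sub_add_cancel hm]⟩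
  have hXlow : ∀ n j, ∀ x ∈ X (j + n) (s (j + n)), (s n).1 ≤ x := fun n j x hx =>
    (hsm.monotone (Nat.le_add_left n j)).trans (hXk _ _ x hx)
  set A : Set ℕ := ⋃ n, (s n).2 with hA
  have hAs : ∀ n, ∀ x ∈ A, x ∈ (s n).2 ∨ ∃ j, x ∈ X (j + n) (s (j + n)) := by
    intro n x hx
    obtain ⟨m, hm⟩ := Set.mem_iUnion.1 hx
    rcases le_total n m with hnm | hnm
    · exact hback n m hnm x hm
    · exact Or.inl (hsub m n hnm hm)
  -- Later pieces start beyond the segment decided at stage `n`, so `A` still avoids every `C n`.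
  have hAC : A ∉ ExhIdeal (familySubmeasure 𝓕 τ) := by
    rw [hmem, not_exists]
    refine fun n => hB n (s n) A fun i hi => ⟨fun hiA => ?_, fun hi' => ?_⟩
    · rcases hAs (n + 1) i hiA with h1 | ⟨j, hj⟩
      · exact h1.1
      · exact absurd (hXlow _ _ _ hj) (not_le.2 hi)
    · exact Set.mem_iUnion.2 ⟨n + 1, hi', hi⟩
  -- Yet a tail of `A` is covered by the pieces from stage `n` on, whose values sum to a geometric
  -- tail.
  refine hAC (mem_exhIdeal_of_forall fun ε hε => ?_)
  have hsum : ∑' n, (2⁻¹ : ℝ≥0∞) ^ n ≠ ∞ := by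
    rw [ENNReal.tsum_geometric, ENNReal.one_sub_inv_two, inv_inv]
    exact ENNReal.ofNat_ne_top
  obtain ⟨n, hn⟩ := ((ENNReal.tendsto_sum_nat_add _ hsum).eventually
    (gt_mem_nhds (pos_iff_ne_zero.2 hε))).exists
  refine ⟨Finset.range (s n).1, le_trans ?_ hn.le⟩
  refine (submeasure_mono (B := ⋃ j, X (j + n) (s (j + n))) ?_).trans
    ((submeasure_iUnion_le _).trans (ENNReal.tsum_le_tsum fun j => hX _ _))
  rintro x ⟨hxA, hx⟩
  rcases hAs n x hxA with h1 | h1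
  · exact absurd (hlt n x h1) (by simpa using hx)
  · exact Set.mem_iUnion.2 h1

/-- A sequence of members of `𝓕` of the same mass `δ` that is almost disjointly measured by
`𝓕`. -/
theorem exists_seq_submeasure_le {δ : ℝ≥0∞} (hδ : δ ≠ 0) (n₀ : ℕ)
    (h : ∀ (ε : ℝ≥0∞) (m n : ℕ), ε ≠ 0 → ∃ F ∈ 𝓕, (∀ x ∈ F, n ≤ x) ∧
      ∑ i ∈ F, (τ i : ℝ≥0∞) = δ ∧ ∀ G ∈ 𝓕, (∃ x ∈ G, x ≤ m) → mass τ F G ≤ ε) :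
    ∃ F : ℕ → Finset ℕ, (∀ j, F j ∈ 𝓕) ∧ (∀ j, ∀ x ∈ F j, n₀ ≤ x) ∧
      (∀ j, (F j).Nonempty) ∧ (∀ i j, i < j → ∀ x ∈ F i, ∀ y ∈ F j, x < y) ∧
      (∀ j, ∑ i ∈ F j, (τ i : ℝ≥0∞) = δ) ∧
      familySubmeasure 𝓕 τ (⋃ j, (F j : Set ℕ)) ≤ 3 * δ := by
  have step : ∀ (n : ℕ) (E : Finset ℕ), ∃ F ∈ 𝓕, (∀ x ∈ F, n₀ ≤ x) ∧ (∀ y ∈ E, ∀ x ∈ F, y < x) ∧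
      ∑ i ∈ F, (τ i : ℝ≥0∞) = δ ∧
      ∀ G ∈ 𝓕, (∃ x ∈ G, ∃ y ∈ E, x ≤ y) → mass τ F G ≤ δ * 2⁻¹ ^ n := by
    intro n E
    obtain ⟨F, hF, hn, hs, hG⟩ := h (δ * 2⁻¹ ^ n) (E.sup id) (max n₀ (E.sup id + 1)) (by simp [hδ])
    refine ⟨F, hF, fun x hx => (le_max_left _ _).trans (hn x hx), fun y hy x hx => ?_, hs, ?_⟩
    · exact Nat.lt_of_lt_of_le (Nat.lt_succ_of_le (Finset.le_sup (f := id) hy))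
        ((le_max_right _ _).trans (hn x hx))
    · rintro G hG' ⟨x, hx, y, hy, hxy⟩
      exact hG G hG' ⟨x, hx, hxy.trans (Finset.le_sup (f := id) hy)⟩
  choose Φ hΦ hlow hlt hsum hmass using step
  obtain ⟨F, hF0, hFs⟩ : ∃ F : ℕ → Finset ℕ, F 0 = Φ 0 ∅ ∧ ∀ j, F (j + 1) = Φ (j + 1) (F j) :=
    ⟨fun n => Nat.rec (Φ 0 ∅) (fun n E => Φ (n + 1) E) n, rfl, fun _ => rfl⟩
  have hF : ∀ j, ∃ E, F j = Φ j E := by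
    rintro (_ | j)
    · exact ⟨∅, hF0⟩
    · exact ⟨F j, hFs j⟩
  have hFsum : ∀ j, ∑ i ∈ F j, (τ i : ℝ≥0∞) = δ := fun j => by
    obtain ⟨E, hE⟩ := hF j
    rw [hE, hsum]
  have hne : ∀ j, (F j).Nonempty := fun j => by
    rw [Finset.nonempty_iff_ne_empty]
    intro h0
    apply hδ
    rw [← hFsum j, h0, Finset.sum_empty]
  have hord : ∀ i j, i < j → ∀ x ∈ F i, ∀ y ∈ F j, x < y := by
    intro i j hij
    induction j, hij using Nat.le_induction with
    | base => exact hFs i ▸ hlt (i + 1) (F i)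
    | succ j _ ih =>
      intro x hx y hy
      obtain ⟨z, hz⟩ := hne j
      exact (ih x hx z hz).trans (hlt (j + 1) (F j) z hz y (hFs j ▸ hy))
  refine ⟨F, fun j => ?_, fun j => ?_, hne, hord, hFsum, submeasure_le fun G hG => ?_⟩
  · obtain ⟨E, hE⟩ := hF j
    exact hE ▸ hΦ _ _
  · obtain ⟨E, hE⟩ := hF j
    exact hE ▸ hlow _ _
  · rcases Classical.em (∃ j : ℕ, ∃ x ∈ G, x ∈ F j) with hex | hex
    · obtain ⟨j₀, ⟨x, hxG, hxF⟩, hmin⟩ : ∃ j, (∃ x ∈ G, x ∈ F j) ∧ ∀ i < j, ¬ ∃ x ∈ G, x ∈ F i := by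
        obtain ⟨j, hj, hmin⟩ := wellFounded_lt.has_min {j | ∃ x ∈ G, x ∈ F j} hex
        exact ⟨j, hj, fun i hi h => hmin i h hi⟩
      -- With `F j₀` the first block met by `G`, earlier blocks contribute `0`, `F j₀` at most `δ`,
      -- and later ones at most `δ * 2⁻¹ ^ j`. The total is at most `δ + 2δ`.
      have hterm : ∀ j : ℕ, mass τ (F j : Set ℕ) G ≤
          Pi.single (M := fun _ => ℝ≥0∞) j₀ δ j + δ * 2⁻¹ ^ j := by
        intro j
        rcases lt_trichotomy j j₀ with hj | rfl | hj
        · rw [mass_eq_zero]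
          · exact zero_le
          · exact fun y hy hyF => hmin j hj ⟨y, hy, hyF⟩
        · rw [Pi.single_eq_same]
          exact ((mass_coe_le_sum _ _).trans (hFsum _).le).trans le_self_add
        · refine le_trans ?_ le_add_self
          obtain ⟨i, rfl⟩ : ∃ i, j = i + 1 := ⟨j - 1, by omega⟩
          rw [hFs]
          refine hmass (i + 1) (F i) G hG ⟨x, hxG, ?_⟩
          rcases (Nat.lt_succ_iff.1 hj).lt_or_eq with hi | hi
          · obtain ⟨z, hz⟩ := hne i
            exact ⟨z, hz, (hord j₀ i hi x hxF z hz).le⟩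
          · exact ⟨x, hi ▸ hxF, le_rfl⟩
      refine (mass_iUnion_le _ _).trans ((ENNReal.tsum_le_tsum hterm).trans ?_)
      rw [ENNReal.tsum_add, ENNReal.tsum_mul_left, ENNReal.tsum_geometric,
        ENNReal.one_sub_inv_two, inv_inv, tsum_pi_single]
      apply le_of_eq
      ring
    · rw [mass_eq_zero]
      · exact zero_le
      · intro x hx hxF
        obtain ⟨j, hj⟩ := Set.mem_iUnion.1 hxF
        exact hex ⟨j, x, hx, hj⟩

end Submeasure

/-! ### Schreier families -/

theorem zeroFamily_hereditary : Hereditary zeroFamily := fun _ hE _ hD =>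
  ⟨(Finset.card_le_card hD).trans hE.1, fun x hx => hE.2 x (hD hx)⟩

/-- A flexible introduction rule: empty blocks are discarded and the rest reindexed increasingly;
having fewer blocks only weakens the bound on the minimum. -/
theorem mem_succFamily {S : Set (Finset ℕ)} {n m : ℕ} (hm : m ≤ n)
    (E : Fin m → Finset ℕ) (hE : ∀ i, E i ∈ S) (hmin : ∀ i, ∀ x ∈ E i, n ≤ x)
    (hord : ∀ i j, i < j → ∀ x ∈ E i, ∀ y ∈ E j, x < y) :
    Finset.univ.biUnion E ∈ succFamily S := by
  classical
  set s : Finset (Fin m) := {i | (E i).Nonempty} with hs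
  have hmem : ∀ i, i ∈ s ↔ (E i).Nonempty := by simp [hs]
  by_cases h0 : s = ∅
  · left
    refine Finset.eq_empty_of_forall_notMem fun x hx => ?_
    obtain ⟨i, -, hi⟩ := Finset.mem_biUnion.1 hx
    have : i ∈ s := (hmem i).2 ⟨x, hi⟩
    simp [h0] at this
  · right
    have hcard : s.card ≤ n := by
      have := s.card_le_univ
      rw [Fintype.card_fin] at this
      omega
    let e := s.orderEmbOfFin rfl
    refine ⟨s.card, Finset.card_pos.2 (Finset.nonempty_iff_ne_empty.2 h0), fun i => E (e i),
      fun i => ⟨hE _, (hmem _).1 (s.orderEmbOfFin_mem rfl i)⟩,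
      fun i x hx => hcard.trans (hmin _ x hx),
      fun i j hij => hord _ _ (e.strictMono hij), ?_⟩
    ext x
    simp only [Finset.mem_biUnion, Finset.mem_univ, true_and]
    refine ⟨fun ⟨i, hi⟩ => ?_, fun ⟨i, hi⟩ => ⟨_, hi⟩⟩
    have : i ∈ Set.range e := by
      rw [Finset.range_orderEmbOfFin]
      exact (hmem i).2 ⟨x, hi⟩
    obtain ⟨j, rfl⟩ := this
    exact ⟨j, hi⟩

theorem succFamily_hereditary {S : Set (Finset ℕ)} (hS : Hereditary S) :
    Hereditary (succFamily S) := by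
  classical
  rintro F (rfl | ⟨n, hn, E, hE, hmin, hord, rfl⟩) D hD
  · exact Or.inl (Finset.subset_empty.1 hD)
  · have : D = Finset.univ.biUnion fun i => E i ∩ D := by
      rw [← Finset.biUnion_inter, Finset.inter_eq_right.2 hD]
    rw [this]
    exact mem_succFamily le_rfl _ (fun i => hS _ (hE i).1 _ Finset.inter_subset_left)
      (fun i x hx => hmin i x (Finset.mem_inter.1 hx).1)
      fun i j hij x hx y hy => hord i j hij x (Finset.mem_inter.1 hx).1 y (Finset.mem_inter.1 hy).1

theorem mem_succFamily_of_mem {S : Set (Finset ℕ)} {E : Finset ℕ} (hE : E ∈ S)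
    (h1 : ∀ x ∈ E, 1 ≤ x) : E ∈ succFamily S := by
  have := mem_succFamily le_rfl (fun _ : Fin 1 => E) (fun _ => hE) (fun _ => h1)
    fun i j hij => absurd hij (by simp)
  simpa using this

variable {ξ : Ordinal.{0} → ℕ → Ordinal.{0}} {α β : Ordinal.{0}}

theorem IsLadderSystem.lt_of_lt (hξ : IsLadderSystem ξ) (hα : α < ω_ 1) (hlim : IsSuccLimit α)
    {k m : ℕ} (hk : 1 ≤ k) (hkm : k < m) : ξ α k < ξ α m := by
  induction m, hkm using Nat.le_induction with
  | base => exact (hξ α hα hlim).1 k hk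
  | succ m hm ih => exact ih.trans ((hξ α hα hlim).1 m (by omega))

theorem schreierFamily_hereditary (hξ : IsLadderSystem ξ) (hα : α < ω_ 1) :
    Hereditary (schreierFamily ξ α) := by
  induction α using Ordinal.limitRecOn with
  | zero =>
    rw [schreierFamily_zero]
    exact zeroFamily_hereditary
  | add_one α ih =>
    rw [← succ_eq_add_one] at hα ⊢
    rw [schreierFamily_succ]
    exact succFamily_hereditary (ih ((lt_succ α).trans hα))
  | limit α hlim ih =>
    rw [schreierFamily_limit hξ hα hlim]
    rintro E (rfl | ⟨k, hk, hE, hS⟩) D hD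
    · exact Or.inl (Finset.subset_empty.1 hD)
    · have hlt := (hξ α hα hlim).2.1 k hk
      exact Or.inr ⟨k, hk, fun x hx => hE x (hD hx), ih _ hlt (hlt.trans hα) E hS D hD⟩

/-- For `α < β`, the sets of `𝓢_α` that start late enough belong to `𝓢_β`. -/
theorem exists_tail_mem (hξ : IsLadderSystem ξ) (hαβ : α < β) (hβ : β < ω_ 1) :
    ∃ N, ∀ E ∈ schreierFamily ξ α, (∀ x ∈ E, N ≤ x) → E ∈ schreierFamily ξ β := by
  induction β using Ordinal.limitRecOn with
  | zero => exact absurd hαβ not_lt_zero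
  | add_one β ih =>
    rw [← succ_eq_add_one] at *
    have hβ' := (lt_succ β).trans hβ
    rw [schreierFamily_succ]
    rcases (lt_succ_iff.1 hαβ).lt_or_eq with h | rfl
    · obtain ⟨N, hN⟩ := ih h hβ'
      exact ⟨max N 1, fun E hE hx => mem_succFamily_of_mem
        (hN E hE fun x h => (le_max_left _ _).trans (hx x h))
        fun x h => (le_max_right _ _).trans (hx x h)⟩
    · exact ⟨1, fun E hE hx => mem_succFamily_of_mem hE hx⟩
  | limit β hlim ih =>
    obtain ⟨-, h2, h3⟩ := hξ β hβ hlim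
    obtain ⟨k, hk, hαk⟩ := h3 α hαβ
    obtain ⟨N, hN⟩ := ih _ (h2 k hk) hαk ((h2 k hk).trans hβ)
    rw [schreierFamily_limit hξ hβ hlim]
    exact ⟨max N k, fun E hE hx => Or.inr ⟨k, hk, fun x h => (le_max_right _ _).trans (hx x h),
      hN E hE fun x h => (le_max_left _ _).trans (hx x h)⟩⟩

theorem exists_tail_mem_of_le (hξ : IsLadderSystem ξ) (hαβ : α ≤ β) (hβ : β < ω_ 1) :
    ∃ N, ∀ E ∈ schreierFamily ξ α, (∀ x ∈ E, N ≤ x) → E ∈ schreierFamily ξ β := by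
  rcases hαβ.lt_or_eq with h | rfl
  · exact exists_tail_mem hξ h hβ
  · exact ⟨0, fun E hE _ => hE⟩

/-! ### Weights -/

theorem coe_lam (k : ℕ) : (lam k : ℝ≥0∞) = 2⁻¹ ^ Nat.log 2 k := by
  rw [lam, ENNReal.coe_pow, ENNReal.coe_inv two_ne_zero, ENNReal.coe_ofNat]

theorem lam_le {n k : ℕ} (h : 2 ^ n ≤ k) : (lam k : ℝ≥0∞) ≤ 2⁻¹ ^ n := by
  rw [coe_lam]
  exact pow_le_pow_right_of_le_one' (by simp) (Nat.le_log_of_pow_le one_lt_two h)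

theorem submeasure_zero_le {A : Set ℕ} {n : ℕ} (hA : ∀ x ∈ A, 2 ^ n ≤ x) :
    schreierSubmeasure ξ 0 A ≤ 2⁻¹ ^ n := by
  refine submeasure_le fun G hG => ?_
  rw [schreierFamily_zero] at hG
  rcases Finset.card_le_one_iff_subset_singleton.1 hG.1 with ⟨a, ha⟩
  rcases Finset.subset_singleton_iff.1 ha with rfl | rfl
  · simp [mass]
  · rw [mass, Finset.sum_singleton]
    by_cases haA : a ∈ A
    · rw [Set.indicator_of_mem haA]
      exact lam_le (hA a haA)
    · rw [Set.indicator_of_notMem haA]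
      exact zero_le

theorem exists_inv_two_pow_le {ε : ℝ≥0∞} (hε : ε ≠ 0) : ∃ n : ℕ, (2⁻¹ : ℝ≥0∞) ^ n ≤ ε := by
  obtain ⟨n, hn⟩ := ENNReal.exists_inv_two_pow_lt hε
  exact ⟨n, by simpa using hn.le⟩

theorem schreierIdeal_zero : schreierIdeal ξ 0 = Set.univ := by
  refine Set.eq_univ_of_forall fun A => mem_exhIdeal_of_forall fun ε hε => ?_
  obtain ⟨n, hn⟩ := exists_inv_two_pow_le hε
  refine ⟨Finset.range (2 ^ n), (submeasure_zero_le fun x hx => ?_).trans hn⟩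
  simpa using hx.2

theorem schreierFamily_one : schreierFamily ξ 1 = succFamily zeroFamily := by
  rw [← zero_add (1 : Ordinal), ← succ_eq_add_one, schreierFamily_succ, schreierFamily_zero]

/-- A set in `𝓢_1` consists of `n` points, all at least `n`, of weight at most `2^(-Nat.log 2 n)`
each; since `n < 2 * 2 ^ Nat.log 2 n`, its mass is at most `2`. -/
theorem finIdeal_one : FinIdeal (schreierSubmeasure ξ 1) = Set.univ := by
  refine Set.eq_univ_of_forall fun A => ?_
  refine lt_of_le_of_lt (b := (2 : ℝ≥0∞)) (submeasure_le fun G hG => ?_) ENNReal.ofNat_lt_top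
  rw [schreierFamily_one] at hG
  rcases hG with rfl | ⟨n, hn, E, hE, hmin, -, rfl⟩
  · simp [mass]
  · refine (mass_biUnion_le _ _ _).trans ?_
    have hterm : ∀ i, mass lam A (E i) ≤ 2⁻¹ ^ Nat.log 2 n := fun i => by
      obtain ⟨a, ha⟩ := Finset.card_eq_one.1 (le_antisymm (hE i).1.1 (hE i).2.card_pos)
      refine (mass_le_sum _ _).trans ?_
      rw [ha, Finset.sum_singleton]
      exact lam_le ((Nat.pow_log_le_self 2 (by omega)).trans (hmin i a (by simp [ha])))
    refine (Finset.sum_le_sum fun i _ => hterm i).trans ?_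
    rw [Finset.sum_const, Finset.card_univ, Fintype.card_fin, nsmul_eq_mul]
    have h1 : (n : ℝ≥0∞) ≤ 2 * 2 ^ Nat.log 2 n := by
      have := (Nat.lt_pow_succ_log_self one_lt_two n).le
      rw [pow_succ, mul_comm] at this
      exact_mod_cast this
    calc (n : ℝ≥0∞) * 2⁻¹ ^ Nat.log 2 n ≤ 2 * 2 ^ Nat.log 2 n * 2⁻¹ ^ Nat.log 2 n := by gcongr
      _ = 2 := by
        rw [mul_assoc, ← mul_pow, ENNReal.mul_inv_cancel two_ne_zero ENNReal.ofNat_ne_top,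
          one_pow, mul_one]

/-! ### Sets of small submeasure outside the ideals -/

/-- `𝓢_β` contains late sets of mass `2⁻ʳ` on which the submeasures of smaller order are small. -/
def HasThinSets (ξ : Ordinal.{0} → ℕ → Ordinal.{0}) (β : Ordinal.{0}) : Prop :=
  ∀ α < β, ∀ (r n : ℕ) (ε : ℝ≥0∞), ε ≠ 0 → ∃ F ∈ schreierFamily ξ β, (∀ x ∈ F, n ≤ x) ∧
    ∑ i ∈ F, (lam i : ℝ≥0∞) = 2⁻¹ ^ r ∧ schreierSubmeasure ξ α F ≤ ε

theorem hasThinSets_one : HasThinSets ξ 1 := by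
  intro α hα r n ε hε
  obtain rfl := Order.lt_one_iff.1 hα
  obtain ⟨p, hp⟩ := exists_inv_two_pow_le hε
  -- The witness is an initial piece of the dyadic interval `[2^N, 2^(N+1))`, where the weight is
  -- constantly `2⁻ᴺ`; `2^(N - r)` points give mass `2⁻ʳ`.
  set N := max (max p r) n with hN
  have hr : r ≤ N := by omega
  have hpow : 2 ^ (N - r) ≤ 2 ^ N := Nat.pow_le_pow_right two_pos (Nat.sub_le N r)
  have hsum : ∑ i ∈ Finset.Ico (2 ^ N) (2 ^ N + 2 ^ (N - r)), (lam i : ℝ≥0∞) = 2⁻¹ ^ r := by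
    rw [Finset.sum_congr rfl (g := fun _ => (2⁻¹ : ℝ≥0∞) ^ N)]
    · rw [Finset.sum_const, Nat.card_Ico, Nat.add_sub_cancel_left, nsmul_eq_mul]
      conv_lhs => rw [← Nat.sub_add_cancel hr, pow_add, Nat.add_sub_cancel, ← mul_assoc]
      rw [Nat.cast_pow, Nat.cast_ofNat, ← mul_pow,
        ENNReal.mul_inv_cancel two_ne_zero ENNReal.ofNat_ne_top, one_pow, one_mul]
    · intro i hi
      rw [Finset.mem_Ico] at hi
      rw [coe_lam, Nat.log_eq_of_pow_le_of_lt_pow hi.1 (by rw [pow_succ]; omega)]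
  refine ⟨Finset.Ico (2 ^ N) (2 ^ N + 2 ^ (N - r)), ?_, ?_, hsum, ?_⟩
  · rw [schreierFamily_one]
    have := mem_succFamily (S := zeroFamily) (n := 2 ^ N) (m := 2 ^ (N - r)) hpow
      (fun i => {2 ^ N + (i : ℕ)})
      (fun i => ⟨by simp, fun x hx => by
        rw [Finset.mem_singleton.1 hx]
        exact Nat.one_le_two_pow.trans (Nat.le_add_right _ _)⟩)
      (fun i x hx => by
        rw [Finset.mem_singleton.1 hx]
        exact Nat.le_add_right _ _)
      (fun i j hij x hx y hy => by
        rw [Finset.mem_singleton.1 hx, Finset.mem_singleton.1 hy]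
        exact Nat.add_lt_add_left hij _)
    convert this using 1
    ext x
    simp only [Finset.mem_Ico, Finset.mem_biUnion, Finset.mem_univ, true_and, Finset.mem_singleton]
    refine ⟨fun ⟨h1, h2⟩ => ⟨⟨x - 2 ^ N, by omega⟩, by simp only; omega⟩, ?_⟩
    rintro ⟨⟨i, hi⟩, rfl⟩
    simp only
    omega
  · intro x hx
    have h1 := (Finset.mem_Ico.1 hx).1
    have h2 : N < 2 ^ N := Nat.lt_two_pow_self
    omega
  · refine (submeasure_zero_le fun x hx => ?_).trans hp
    exact (Nat.pow_le_pow_right two_pos (by omega)).trans (Finset.mem_Ico.1 hx).1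

/-- An element of `G` below `m` bounds its complexity. For `β = γ + 1`, `G` splits into at most `m`
members of `𝓢_γ`. For limit `β`, `G` lies in `𝓢_{ξ β k}` with `k ≤ m`, and on late sets these
finitely many families are dominated by the one of order `ξ β (m + 1)`. -/
theorem HasThinSets.exists_mass_le (hξ : IsLadderSystem ξ) (hβ : β < ω_ 1) (h0 : β ≠ 0)
    (h : HasThinSets ξ β) (r m n : ℕ) {ε : ℝ≥0∞} (hε : ε ≠ 0) :
    ∃ F ∈ schreierFamily ξ β, (∀ x ∈ F, n ≤ x) ∧ ∑ i ∈ F, (lam i : ℝ≥0∞) = 2⁻¹ ^ r ∧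
      ∀ G ∈ schreierFamily ξ β, (∃ x ∈ G, x ≤ m) → mass lam F G ≤ ε := by
  rcases Ordinal.zero_or_succ_or_isSuccLimit β with rfl | ⟨γ, rfl⟩ | hlim
  · exact absurd rfl h0
  -- Dividing by `m + 1` instead of `m` keeps the divisor nonzero.
  · obtain ⟨F, hF, hn, hs, hφ⟩ := h γ (lt_succ γ) r n (ε / (m + 1 : ℕ))
      (ENNReal.div_ne_zero.2 ⟨hε, ENNReal.natCast_ne_top _⟩)
    refine ⟨F, hF, hn, hs, ?_⟩
    rintro G hG ⟨x, hxG, hxm⟩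
    rw [schreierFamily_succ] at hG
    rcases hG with rfl | ⟨l, hl, E, hE, hmin, -, rfl⟩
    · simp at hxG
    · obtain ⟨i, -, hi⟩ := Finset.mem_biUnion.1 hxG
      have hlm : l ≤ m + 1 := ((hmin i x hi).trans hxm).trans (Nat.le_succ m)
      refine (mass_biUnion_le _ _ _).trans ((Finset.sum_le_sum fun i _ =>
        (mass_le_submeasure (hE i).1 _).trans hφ).trans ?_)
      rw [Finset.sum_const, Finset.card_univ, Fintype.card_fin, nsmul_eq_mul]
      calc (l : ℝ≥0∞) * (ε / (m + 1 : ℕ)) ≤ (m + 1 : ℕ) * (ε / (m + 1 : ℕ)) := by gcongr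
        _ ≤ ε := ENNReal.mul_div_le
  · obtain ⟨-, h2, -⟩ := hξ β hβ hlim
    have htail : ∀ k, ∃ N, 1 ≤ k → k ≤ m → ∀ E ∈ schreierFamily ξ (ξ β k), (∀ x ∈ E, N ≤ x) →
        E ∈ schreierFamily ξ (ξ β (m + 1)) := by
      intro k
      by_cases hk : 1 ≤ k ∧ k ≤ m
      · obtain ⟨N, hN⟩ := exists_tail_mem hξ
          (hξ.lt_of_lt hβ hlim hk.1 (Nat.lt_succ_of_le hk.2)) ((h2 (m + 1) (by omega)).trans hβ)
        exact ⟨N, fun _ _ => hN⟩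
      · exact ⟨0, fun h1 h2 => absurd ⟨h1, h2⟩ hk⟩
    choose N hN using htail
    obtain ⟨F, hF, hn, hs, hφ⟩ := h _ (h2 (m + 1) (by omega)) r
      (max n ((Finset.range (m + 1)).sup N)) ε hε
    refine ⟨F, hF, fun x hx => (le_max_left _ _).trans (hn x hx), hs, ?_⟩
    rintro G hG ⟨x, hxG, hxm⟩
    rw [schreierFamily_limit hξ hβ hlim] at hG
    rcases hG with rfl | ⟨k, hk, hkG, hG⟩
    · simp at hxG
    · have hkm : k ≤ m := (hkG x hxG).trans hxm
      refine (mass_le_submeasure_of_tail (schreierFamily_hereditary hξ ((h2 k hk).trans hβ))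
        (hN k hk hkm) (fun y hy => ?_) hG).trans hφ
      exact (Finset.le_sup (f := N) (Finset.mem_range.2 (Nat.lt_succ_of_le hkm))).trans
        ((le_max_right _ _).trans (hn y hy))

theorem HasThinSets.exists_seq (hξ : IsLadderSystem ξ) (hβ : β < ω_ 1) (h0 : β ≠ 0)
    (h : HasThinSets ξ β) (r n : ℕ) :
    ∃ F : ℕ → Finset ℕ, (∀ j, F j ∈ schreierFamily ξ β) ∧ (∀ j, ∀ x ∈ F j, n ≤ x) ∧
      (∀ j, (F j).Nonempty) ∧ (∀ i j, i < j → ∀ x ∈ F i, ∀ y ∈ F j, x < y) ∧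
      (∀ j, ∑ i ∈ F j, (lam i : ℝ≥0∞) = 2⁻¹ ^ r) ∧
      schreierSubmeasure ξ β (⋃ j, (F j : Set ℕ)) ≤ 3 * 2⁻¹ ^ r :=
  exists_seq_submeasure_le (by simp) n fun _ m n hε => h.exists_mass_le hξ hβ h0 r m n hε

theorem biUnion_mem_schreierFamily_succ {F : ℕ → Finset ℕ} (hF : ∀ j, F j ∈ schreierFamily ξ β)
    (hord : ∀ i j, i < j → ∀ x ∈ F i, ∀ y ∈ F j, x < y) {n : ℕ}
    (hmin : ∀ j, ∀ x ∈ F j, n ≤ x) :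
    (Finset.range n).biUnion F ∈ schreierFamily ξ (succ β) := by
  rw [schreierFamily_succ]
  have := mem_succFamily le_rfl (fun i : Fin n => F i) (fun i => hF i) (fun i => hmin i)
    fun i j hij => hord i j hij
  convert this using 1
  ext x
  simp only [Finset.mem_biUnion, Finset.mem_range, Finset.mem_univ, true_and]
  exact ⟨fun ⟨i, hi, hx⟩ => ⟨⟨i, hi⟩, hx⟩, fun ⟨i, hx⟩ => ⟨i, i.2, hx⟩⟩

theorem sum_biUnion_range {F : ℕ → Finset ℕ}
    (hord : ∀ i j, i < j → ∀ x ∈ F i, ∀ y ∈ F j, x < y) (f : ℕ → ℝ≥0∞) (n : ℕ) :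
    ∑ i ∈ (Finset.range n).biUnion F, f i = ∑ j ∈ Finset.range n, ∑ i ∈ F j, f i := by
  refine Finset.sum_biUnion fun i _ j _ hij => Finset.disjoint_left.2 fun x hi hj => ?_
  rcases lt_or_gt_of_ne hij with h | h
  · exact lt_irrefl x (hord i j h x hi x hj)
  · exact lt_irrefl x (hord j i h x hj x hi)

/-- At a successor, splitting the mass `2⁻ʳ` among `2ˢ` almost independent blocks makes `φ_β` as
small as desired, and late enough sets have `φ_α ≤ φ_β` for `α ≤ β`. At a limit, a thin set for some
`ξ β k > α` that starts past `k` works. -/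
theorem hasThinSets (hξ : IsLadderSystem ξ) (hβ : β < ω_ 1) : HasThinSets ξ β := by
  induction β using Ordinal.limitRecOn with
  | zero => exact fun α hα => absurd hα not_lt_zero
  | add_one β ih =>
    rw [← succ_eq_add_one] at *
    have hβ' := (lt_succ β).trans hβ
    by_cases h0 : β = 0
    · rw [h0, succ_eq_add_one, zero_add]
      exact hasThinSets_one
    intro α hα r n ε hε
    have hαβ := lt_succ_iff.1 hα
    obtain ⟨N, hN⟩ := exists_tail_mem_of_le hξ hαβ hβ'
    obtain ⟨s, hs⟩ := exists_inv_two_pow_le (ε := ε / 3)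
      (ENNReal.div_ne_zero.2 ⟨hε, ENNReal.ofNat_ne_top⟩)
    obtain ⟨F, hF, hmin, -, hord, hsum, hφ⟩ := (ih hβ').exists_seq hξ hβ' h0 (r + s)
      (max (max n N) (2 ^ s))
    have hlow : ∀ x ∈ (Finset.range (2 ^ s)).biUnion F, max (max n N) (2 ^ s) ≤ x := by
      intro x hx
      obtain ⟨j, -, hj⟩ := Finset.mem_biUnion.1 hx
      exact hmin j x hj
    refine ⟨(Finset.range (2 ^ s)).biUnion F, ?_, fun x hx => ?_, ?_, ?_⟩
    · exact biUnion_mem_schreierFamily_succ hF hord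
        fun j x hx => (le_max_right _ _).trans (hmin j x hx)
    · exact ((le_max_left _ _).trans (le_max_left _ _)).trans (hlow x hx)
    · rw [sum_biUnion_range hord, Finset.sum_congr rfl fun j _ => hsum j, Finset.sum_const,
        Finset.card_range, nsmul_eq_mul, Nat.cast_pow, Nat.cast_ofNat, add_comm r, pow_add,
        ← mul_assoc, ← mul_pow, ENNReal.mul_inv_cancel two_ne_zero ENNReal.ofNat_ne_top,
        one_pow, one_mul]
    · calc schreierSubmeasure ξ α ((Finset.range (2 ^ s)).biUnion F : Finset ℕ)
          ≤ schreierSubmeasure ξ β ((Finset.range (2 ^ s)).biUnion F : Finset ℕ) :=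
            submeasure_le_of_tail (schreierFamily_hereditary hξ (hαβ.trans_lt hβ')) hN
              fun x hx => ((le_max_right _ _).trans (le_max_left _ _)).trans (hlow x hx)
        _ ≤ schreierSubmeasure ξ β (⋃ j, (F j : Set ℕ)) := submeasure_mono fun x hx => by
            obtain ⟨j, -, hj⟩ := Finset.mem_biUnion.1 (Finset.mem_coe.1 hx)
            exact Set.mem_iUnion.2 ⟨j, hj⟩
        _ ≤ 3 * 2⁻¹ ^ (r + s) := hφ
        _ ≤ 3 * (ε / 3) := by
            gcongr
            exact (pow_le_pow_right_of_le_one' (by simp) (Nat.le_add_left s r)).trans hs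
        _ ≤ ε := ENNReal.mul_div_le
  | limit β hlim ih =>
    intro α hα r n ε hε
    obtain ⟨-, h2, h3⟩ := hξ β hβ hlim
    obtain ⟨k, hk, hαk⟩ := h3 α hα
    obtain ⟨F, hF, hn, hs, hφ⟩ := ih _ (h2 k hk) ((h2 k hk).trans hβ) α hαk r (max n k) ε hε
    refine ⟨F, ?_, fun x hx => (le_max_left _ _).trans (hn x hx), hs, hφ⟩
    rw [schreierFamily_limit hξ hβ hlim]
    exact Or.inr ⟨k, hk, fun x hx => (le_max_right _ _).trans (hn x hx), hF⟩

theorem not_isFSigma_schreierIdeal (hξ : IsLadderSystem ξ) (h0 : β ≠ 0) (hβ : β < ω_ 1) :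
    ¬ IsFSigma (schreierIdeal ξ β) := by
  refine not_isFSigma_exhIdeal fun δ hδ => ?_
  obtain ⟨r, hr⟩ := exists_inv_two_pow_le (ε := δ / 3)
    (ENNReal.div_ne_zero.2 ⟨hδ, ENNReal.ofNat_ne_top⟩)
  obtain ⟨F, hF, -, hne, hord, hsum, hφ⟩ := (hasThinSets hξ hβ).exists_seq hξ hβ h0 r 0
  refine ⟨_, hφ.trans (le_trans (by gcongr) (ENNReal.mul_div_le (a := 3))),
    notMem_exhIdeal (ε := 2⁻¹ ^ r) (by simp) fun k =>
    ⟨F k, hF k, Set.subset_iUnion (fun j => (F j : Set ℕ)) k, ?_, (hsum k).ge⟩⟩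
  -- Successive nonempty blocks drift to infinity: `F k` lies in `[k, ∞)`.
  induction k with
  | zero => exact fun x _ => Nat.zero_le x
  | succ k ih =>
    intro x hx
    obtain ⟨z, hz⟩ := hne k
    exact (ih z hz).trans_lt (hord k (k + 1) (Nat.lt_succ_self k) z hz x hx)

/-! ### Inclusions -/

theorem schreierIdeal_ssubset_finIdeal (hξ : IsLadderSystem ξ) (h0 : β ≠ 0) (hβ : β < ω_ 1) :
    schreierIdeal ξ β ⊂ FinIdeal (schreierSubmeasure ξ β) :=
  exhIdeal_subset_finIdeal.ssubset_of_ne fun h =>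
    not_isFSigma_schreierIdeal hξ h0 hβ (Eq.subst (motive := IsFSigma) h.symm isFSigma_finIdeal)

theorem finIdeal_succ_subset (hξ : IsLadderSystem ξ) (hα : α < ω_ 1) :
    FinIdeal (schreierSubmeasure ξ (succ α)) ⊆ schreierIdeal ξ α := by
  classical
  intro A hA
  by_contra hnot
  obtain ⟨ε, hε0, hε⟩ := exists_between (pos_iff_ne_zero.2 hnot)
  have step : ∀ n : ℕ, ∃ E ∈ schreierFamily ξ α, (∀ x ∈ E, n ≤ x) ∧ ε ≤ mass lam A E := by
    intro n
    have h1 : ε < schreierSubmeasure ξ α (A \ (Finset.range n : Set ℕ)) :=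
      hε.trans_le (iInf_le _ _)
    obtain ⟨G, h1⟩ := lt_iSup_iff.1 h1
    obtain ⟨hG, h1⟩ := lt_iSup_iff.1 h1
    refine ⟨{x ∈ G | x ∈ A \ (Finset.range n : Set ℕ)},
      schreierFamily_hereditary hξ hα G hG _ (Finset.filter_subset _ _), fun x hx => ?_, ?_⟩
    · simpa using (Finset.mem_filter.1 hx).2.2
    · exact h1.le.trans ((mass_filter _ _).ge.trans (mass_mono Set.sdiff_subset _))
  choose E hE hlow hmass using step
  have key : ∀ n : ℕ, n * ε ≤ schreierSubmeasure ξ (succ α) A := by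
    intro n
    -- Each start `e (j + 1)` is beyond the block `E (e j)`, and all starts are at least `n`, so `n`
    -- consecutive blocks are admissible for `𝓢_{α+1}`.
    let e : ℕ → ℕ := fun j => Nat.rec n (fun _ p => max n ((E p).sup id + 1)) j
    have he : ∀ j, n ≤ e j := by
      rintro (_ | j)
      · exact le_rfl
      · exact le_max_left _ _
    have hne : ∀ p, (E p).Nonempty := fun p => by
      rw [Finset.nonempty_iff_ne_empty]
      intro h
      have := hmass p
      rw [h] at this
      exact absurd this (not_le.2 (by simpa [mass] using hε0))
    have hstep : ∀ j, ∀ x ∈ E (e j), ∀ y ∈ E (e (j + 1)), x < y := fun j x hx y hy =>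
      Nat.lt_of_lt_of_le (Nat.lt_succ_of_le (Finset.le_sup (f := id) hx))
        ((le_max_right n _).trans (hlow _ y hy))
    have hord : ∀ i j, i < j → ∀ x ∈ E (e i), ∀ y ∈ E (e j), x < y := by
      intro i j hij
      induction j, hij using Nat.le_induction with
      | base => exact hstep i
      | succ j _ ih =>
        intro x hx y hy
        obtain ⟨z, hz⟩ := hne (e j)
        exact (ih x hx z hz).trans (hstep j z hz y hy)
    have hmem := biUnion_mem_schreierFamily_succ (fun j => hE (e j)) hord
      fun j x hx => (he j).trans (hlow _ x hx)
    refine le_trans ?_ (mass_le_submeasure hmem A)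
    rw [mass, sum_biUnion_range hord]
    calc (n : ℝ≥0∞) * ε = ∑ j ∈ Finset.range n, ε := by simp
      _ ≤ _ := Finset.sum_le_sum fun j _ => hmass (e j)
  have hlt : schreierSubmeasure ξ (succ α) A / ε < ∞ := ENNReal.div_lt_top hA.ne hε0.ne'
  obtain ⟨n, hn⟩ := ENNReal.exists_nat_gt hlt.ne
  have hεtop : ε ≠ ∞ := (hε.trans_le le_top).ne
  have h1 := key (n + 1)
  rw [← ENNReal.le_div_iff_mul_le (Or.inl hε0.ne') (Or.inl hεtop)] at h1
  refine absurd (h1.trans_lt hn) (not_lt.2 ?_)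
  exact_mod_cast Nat.le_succ n

theorem finIdeal_subset_of_le (hξ : IsLadderSystem ξ) (hαβ : α ≤ β) (hβ : β < ω_ 1) :
    FinIdeal (schreierSubmeasure ξ β) ⊆ FinIdeal (schreierSubmeasure ξ α) := by
  intro A hA
  obtain ⟨N, hN⟩ := exists_tail_mem_of_le hξ hαβ hβ
  refine submeasure_lt_top_of_diff (Finset.range N) (lt_of_le_of_lt ?_ hA)
  refine (submeasure_le_of_tail (schreierFamily_hereditary hξ (hαβ.trans_lt hβ)) hN ?_).trans
    (submeasure_mono Set.sdiff_subset)
  intro x hx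
  simpa using hx.2

theorem finIdeal_subset_schreierIdeal (hξ : IsLadderSystem ξ) (hαβ : α < β) (hβ : β < ω_ 1) :
    FinIdeal (schreierSubmeasure ξ β) ⊆ schreierIdeal ξ α :=
  (finIdeal_subset_of_le hξ (succ_le_of_lt hαβ) hβ).trans
    (finIdeal_succ_subset hξ (hαβ.trans hβ))

theorem finIdeal_ssubset_schreierIdeal (hξ : IsLadderSystem ξ) (hαβ : α < β) (hβ : β < ω_ 1)
    (hne : ¬ (α = 0 ∧ β = 1)) :
    FinIdeal (schreierSubmeasure ξ β) ⊂ schreierIdeal ξ α := by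
  refine (finIdeal_subset_schreierIdeal hξ hαβ hβ).ssubset_of_ne fun h => ?_
  -- `𝓘_0` is everything, hence `F_σ`, so complexity does not separate it from `Fin(φ_β)`. Instead
  -- `Fin(φ_β) ⊆ 𝓘_1` for `β > 1`, and `𝓘_1` is not everything.
  by_cases h0 : α = 0
  · subst h0
    have h1 : 1 < β := lt_of_le_of_ne (Order.one_le_iff_pos.2 hαβ) fun h => hne ⟨rfl, h.symm⟩
    have h2 := finIdeal_subset_schreierIdeal hξ h1 hβ
    rw [h, schreierIdeal_zero, Set.univ_subset_iff] at h2
    exact not_isFSigma_schreierIdeal hξ one_ne_zero (h1.trans hβ)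
      (Eq.subst (motive := IsFSigma) h2.symm isFSigma_univ)
  · exact not_isFSigma_schreierIdeal hξ h0 (hαβ.trans hβ)
      (Eq.subst (motive := IsFSigma) h isFSigma_finIdeal)

end SchreierIdeals

theorem mainTheorem6 (ξ : Ordinal.{0} → ℕ → Ordinal.{0}) (hξ : SchreierIdeals.IsLadderSystem ξ) :
    (∀ β : Ordinal.{0}, 0 < β → β < ω_ 1 →
      ¬ SchreierIdeals.IsFSigma (SchreierIdeals.schreierIdeal ξ β)) ∧
    (∀ α β : Ordinal.{0}, α < β → β < ω_ 1 →
      SchreierIdeals.schreierIdeal ξ β ⊂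
        SchreierIdeals.FinIdeal (SchreierIdeals.schreierSubmeasure ξ β) ∧
      (¬ (α = 0 ∧ β = 1) →
        SchreierIdeals.FinIdeal (SchreierIdeals.schreierSubmeasure ξ β) ⊂
          SchreierIdeals.schreierIdeal ξ α)) ∧
    (SchreierIdeals.FinIdeal (SchreierIdeals.schreierSubmeasure ξ 1) = Set.univ ∧
      SchreierIdeals.schreierIdeal ξ 0 = Set.univ) ∧
    (∀ β : Ordinal.{0}, Order.IsSuccLimit β → β < ω_ 1 →
      SchreierIdeals.schreierIdeal ξ β ⊂
        ⋂ α ∈ Set.Iio β, SchreierIdeals.schreierIdeal ξ α) := by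
  refine ⟨fun β h0 hβ => SchreierIdeals.not_isFSigma_schreierIdeal hξ h0.ne' hβ,
    fun α β hαβ hβ => ⟨?_, SchreierIdeals.finIdeal_ssubset_schreierIdeal hξ hαβ hβ⟩,
    ⟨SchreierIdeals.finIdeal_one, SchreierIdeals.schreierIdeal_zero⟩, fun β hlim hβ => ?_⟩
  · exact SchreierIdeals.schreierIdeal_ssubset_finIdeal hξ (pos_of_gt hαβ).ne' hβ
  -- `Fin(φ_β)` lies between the two sides and already differs from `𝓘_β`.
  · exact (SchreierIdeals.schreierIdeal_ssubset_finIdeal hξ hlim.bot_lt.ne' hβ).trans_subset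
      (Set.subset_iInter₂ fun α hα =>
        SchreierIdeals.finIdeal_subset_schreierIdeal hξ hα hβ)
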